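/- Setting. Let $\mathcal X=\{1,\dots,k\}$, let $Q$ be a strictly positive probability vector on $\mathcal X$, let $h:\mathcal X\to\mathbb R^d$, and write $A=[h(1)\cdots h(k)]$ and $\mathsf T=\{v\in\mathbb R^k:\sum_x v_x=0,\ Av=0\}$; assume $\mathsf T\neq\{0\}$. Let $\Theta\subset\mathbb R^p$ be measurable and $\alpha:\Theta\to\mathbb R^d$ continuous, such that for each $\theta\in\Theta$ the set $E_\theta=\{P: P(x)>0\ \forall x,\ \sum_xP(x)=1,\ \sum_x P(x)h(x)=\alpha(\theta)\}$ is non-empty. Let $P_\theta^*$ be the minimizer over $P\in E_\theta$ of $\sum_xP(x)\log\frac{P(x)}{Q(x)}$, let $H_\theta^*=\Pi_{\mathsf T}\,\mathrm{diag}(1/P_\theta^*)\,\Pi_{\mathsf T}$ regarded as an operator on $\mathsf T$ ($\Pi_{\mathsf T}$ the orthogonal projection onto $\mathsf T$), and let $\lambda_{\min}(H_\theta^*)$ be its smallest eigenvalue. Let $\theta_0$ be an interior point of $\Theta$ at which $\alpha$ is differentiable with injective derivative, and suppose that $\inf\{\|\alpha(\theta)-\alpha(\theta_0)\|:\theta\in\Theta,\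 \|\theta-\theta_0\|\ge\varepsilon\}>0$ for every $\varepsilon>0$. Let $\pi$ be a prior probability measure on $\Theta$ that has a positive continuous Lebesgue density on a neighbourhood of $\theta_0$. The BETEL posterior given $x_{1:n}\in\mathcal X^n$ is $$\pi(d\theta\mid x_{1:n})\ \propto\ \prod_{i=1}^nP_\theta^*(x_i)\ \pi(d\theta),$$ and the BETEL predictive law of $m$ future observations is $\mu_{n,m}^{\mathrm{BETEL}}=\int (P_\theta^*)^{\otimes m}\,\pi(d\theta\mid x_{1:n})$. Let $r_n=\sqrt{\dfrac{\log n}{n\,\lambda_{\min}(H_{\theta_0}^*)}}$. Observations. Let $X_1,X_2,\dots$ be i.i.d. in $\mathcal X$ with $\mathbb E[h(X_1)]=\alpha(\theta_0)$ (for example $X_i\sim Q$ if $Q\in E_{\theta_0}$). Corollary (Posterior concentration). The BETEL posterior is a well-defined probability measure for every sample, and the following hold. 1. For every $c>0$ there are constants $C,K>0$ such that, almost surely, for all sufficiently large $n$, $$\pi\big(\|\theta-\theta_0\|_2>C\,r_n\ \big|\ X_{1:n}\big)\le K n^{-c}.$$ 2. There is a constant $K>0$ such that, almost surely, for all sufficiently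 large $n$ and for every $m\ge 0$, $$\big\|\mu_{n,m}^{\mathrm{BETEL}}-(P_{\theta_0}^*)^{\otimes m}\big\|_{\mathrm{TV}}\le K\,m\,r_n,$$ where $\|\mu-\nu\|_{\mathrm{TV}}=\sup_B|\mu(B)-\nu(B)|$. With the same constants, both bounds also hold, for all sufficiently large $n$, simultaneously for all samples $x_{1:n}\in\mathcal X^n$ whose empirical measure $P_n$ lies in $E_{\theta_0}$ (hence under any law of the data conditioned on $P_n\in E_{\theta_0}$). The constants may depend on $Q,h,\alpha,\Theta,\theta_0,\pi$ and the law of $X_1$, but not on $n$ or $m$ or, beyond that, on the observed sample. -/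

import Mathlib

open MeasureTheory ProbabilityTheory Filter Topology

noncomputable section

namespace BETEL

/-- The open simplex of strictly positive probability vectors on `Fin k`. -/
def openSimplex (k : ℕ) : Set (Fin k → ℝ) :=
  {P | (∀ x, 0 < P x) ∧ ∑ x, P x = 1}

/-- The feasible set: strictly positive laws `P` with `E_P[h] = a`. -/
def feasible {k d : ℕ} (h : Fin k → EuclideanSpace ℝ (Fin d)) (a : EuclideanSpace ℝ (Fin d)) :
    Set (Fin k → ℝ) :=
  {P | P ∈ openSimplex k ∧ ∑ x, P x • h x = a}

/-- Kullback-Leibler divergence of laws on a finite set. -/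
def kl {k : ℕ} (P Q : Fin k → ℝ) : ℝ := ∑ x, P x * Real.log (P x / Q x)

open Classical in
/-- The information projection `argmin {kl P Q : P ∈ feasible h a}` of `Q`.
The value `Q` is a dummy, used only if there is no minimizer. -/
def infoProj {k d : ℕ} (Q : Fin k → ℝ) (h : Fin k → EuclideanSpace ℝ (Fin d))
    (a : EuclideanSpace ℝ (Fin d)) : Fin k → ℝ :=
  if H : ∃ P ∈ feasible h a, IsMinOn (fun P => kl P Q) (feasible h a) P then H.choose else Q

/-- The tangent space `{v : ∑ x, v x = 0, A v = 0}`, where `A` has the columns `h x`. -/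
def tangentSpace {k d : ℕ} (h : Fin k → EuclideanSpace ℝ (Fin d)) :
    Submodule ℝ (EuclideanSpace ℝ (Fin k)) where
  carrier := {v | ∑ x, v x = 0 ∧ ∑ x, v x • h x = 0}
  zero_mem' := by simp
  add_mem' := by
    rintro v w ⟨hv, hv'⟩ ⟨hw, hw'⟩
    constructor
    · simp [Finset.sum_add_distrib, hv, hw]
    · simp [add_smul, Finset.sum_add_distrib, hv', hw']
  smul_mem' := by
    rintro c v ⟨hv, hv'⟩
    constructor
    · simp [← Finset.mul_sum, hv]
    · simp [mul_smul, ← Finset.smul_sum, hv']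

/-- The projected Hessian `v ↦ Π_T (diag (1 / P) v)`, as an endomorphism of the tangent space. -/
def projHessian {k d : ℕ} (h : Fin k → EuclideanSpace ℝ (Fin d)) (P : Fin k → ℝ) :
    Module.End ℝ (tangentSpace h) :=
  (tangentSpace h).orthogonalProjectionOnto.toLinearMap ∘ₗ
    Matrix.toEuclideanLin (Matrix.diagonal fun x => 1 / P x) ∘ₗ (tangentSpace h).subtype

/-- The smallest eigenvalue of the projected Hessian. -/
def curvature {k d : ℕ} (h : Fin k → EuclideanSpace ℝ (Fin d)) (P : Fin k → ℝ) : ℝ :=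
  sInf {μ : ℝ | (projHessian h P).HasEigenvalue μ}

/-- The empirical measure of a sample. -/
def empirical {k n : ℕ} (x : Fin n → Fin k) : Fin k → ℝ :=
  fun y => ((Finset.univ.filter fun i => x i = y).card : ℝ) / n

/-- The law of `m` independent draws from `P`, as a mass function. -/
def iidLaw {k : ℕ} (P : Fin k → ℝ) (m : ℕ) : (Fin m → Fin k) → ℝ :=
  fun y => ∏ j, P (y j)

/-- Total variation distance (supremum over events) of mass functions on a finite set. -/
def tvDist {ι : Type*} (μ ν : ι → ℝ) : ℝ :=
  ⨆ A : Finset ι, |∑ y ∈ A, μ y - ∑ y ∈ A, ν y|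

variable {k d p : ℕ}

/-- The posterior law of the parameter: the prior reweighted by the likelihood
`∏ i, P*_θ (x i)` and normalized, where `P*_θ` is the information projection of `Q` onto
`{P : E_P[h] = α θ}`. -/
def posterior (Q : Fin k → ℝ) (h : Fin k → EuclideanSpace ℝ (Fin d))
    (α : EuclideanSpace ℝ (Fin p) → EuclideanSpace ℝ (Fin d))
    (prior : Measure (EuclideanSpace ℝ (Fin p))) {n : ℕ} (x : Fin n → Fin k) :
    Measure (EuclideanSpace ℝ (Fin p)) :=
  (∫⁻ θ, ENNReal.ofReal (iidLaw (infoProj Q h (α θ)) n x) ∂prior)⁻¹ •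
    prior.withDensity fun θ => ENNReal.ofReal (iidLaw (infoProj Q h (α θ)) n x)

/-- The posterior predictive law of `m` future observations, as a mass function. -/
def predictive (Q : Fin k → ℝ) (h : Fin k → EuclideanSpace ℝ (Fin d))
    (α : EuclideanSpace ℝ (Fin p) → EuclideanSpace ℝ (Fin d))
    (prior : Measure (EuclideanSpace ℝ (Fin p))) {n : ℕ} (x : Fin n → Fin k) (m : ℕ) :
    (Fin m → Fin k) → ℝ :=
  fun y => ∫ θ, iidLaw (infoProj Q h (α θ)) m y ∂(posterior Q h α prior x)

/-- The rate `√(log n / (n lam))`. -/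
def rate (n : ℕ) (lam : ℝ) : ℝ := Real.sqrt (Real.log n / (n * lam))

end BETEL

end

open MeasureTheory ProbabilityTheory Filter Topology

namespace BETEL

variable {k d p : ℕ}

/-! The first-order condition says that `log (P*_θ / Q)` annihilates the tangent space, so its sum
against a signed measure depends only on the mass and the moments of that measure
(`sum_mul_log_infoProj_congr`). The empirical measure, which may vanish at some points, can thus be
traded for a strictly positive law `S` near `P*_θ₀` with the same moments, and the likelihood
becomes `D * exp (-n * kl S P*_θ)` with `D` free of `θ` (`exists_iidLaw_infoProj_eq`).

Divergence is comparable to squared sup distance (`sq_norm_sub_le_kl`, `kl_le_sq_norm_sub`). Put `s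
= √(log n / n)` and let the sample moments be within `O(s)` of `α θ₀`. On the ball of radius `s`
about `θ₀`, Lipschitz dependence of the projection gives `kl = O(s²)`, hence a likelihood of at
least `D n^(-G)`, on prior mass of order at least `s^p ≥ n^(-p/2)`. Where `‖θ - θ₀‖ > C s`,
identification separates `α θ` from the sample moments, hence `P*_θ` from `S`, and the likelihood is
at most `D n^(-w²)`. A large `w` wins (`exists_posterior_le`).

The moment condition holds almost surely by Hoeffding and Borel-Cantelli, and trivially for feasible
empirical measures. The predictive law is a posterior average of product laws, whose `ℓ¹` distances
grow at most linearly in `m`. The curvature enters only as a positive constant, absorbed into `C`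
and `K`. -/

/-! ### Quadratic bounds on the Kullback-Leibler divergence. -/

lemma mul_log_div_sub_add_le {p r : ℝ} (hp : 0 < p) (hr : 0 < r) :
    p * Real.log (p / r) - p + r ≤ (p - r) ^ 2 / r := by
  have h := mul_le_mul_of_nonneg_left (Real.log_le_sub_one_of_pos (div_pos hp hr)) hp.le
  have e : (p - r) ^ 2 / r = p * (p / r - 1) - p + r := by field_simp; ring
  linarith

/-- With `p = a²` and `r = b²`, the inequality `log (b / a) ≤ b / a - 1` bounds the right side below
by the Hellinger term `(a - b)²`, and `(a + b)² ≤ 4` turns this into `(p - r)² / 4`. -/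
lemma sq_sub_div_four_le {p r : ℝ} (hp : 0 < p) (hp1 : p ≤ 1) (hr : 0 < r) (hr1 : r ≤ 1) :
    (p - r) ^ 2 / 4 ≤ p * Real.log (p / r) - p + r := by
  obtain ⟨a, ha, rfl⟩ : ∃ a : ℝ, 0 < a ∧ p = a ^ 2 :=
    ⟨√p, Real.sqrt_pos.2 hp, (Real.sq_sqrt hp.le).symm⟩
  obtain ⟨b, hb, rfl⟩ : ∃ b : ℝ, 0 < b ∧ r = b ^ 2 :=
    ⟨√r, Real.sqrt_pos.2 hr, (Real.sq_sqrt hr.le).symm⟩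
  have ha1 : a ≤ 1 := by nlinarith
  have hb1 : b ≤ 1 := by nlinarith
  have hlog : Real.log (a ^ 2 / b ^ 2) = -2 * Real.log (b / a) := by
    rw [← div_pow, Real.log_pow, ← inv_div b a, Real.log_inv]; push_cast; ring
  have h := mul_le_mul_of_nonneg_left (Real.log_le_sub_one_of_pos (div_pos hb ha)) (sq_nonneg a)
  have e : a ^ 2 * (b / a - 1) = a * b - a ^ 2 := by field_simp
  have h1 : (a - b) ^ 2 ≤ a ^ 2 * Real.log (a ^ 2 / b ^ 2) - a ^ 2 + b ^ 2 := by
    rw [hlog]; nlinarith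
  have h2 : (a + b) ^ 2 ≤ 4 := by nlinarith
  have h3 := mul_le_mul_of_nonneg_left h2 (sq_nonneg (a - b))
  nlinarith

lemma le_one_of_mem_openSimplex {P : Fin k → ℝ} (hP : P ∈ openSimplex k) (x : Fin k) : P x ≤ 1 :=
  hP.2 ▸ Finset.single_le_sum (fun y _ => (hP.1 y).le) (Finset.mem_univ x)

/-- The correction `-P x + R x` has total zero and makes every summand nonnegative, so that single
coordinates are controlled by the whole sum. -/
lemma kl_eq_sum {P R : Fin k → ℝ} (hP : P ∈ openSimplex k) (hR : R ∈ openSimplex k) :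
    kl P R = ∑ x, (P x * Real.log (P x / R x) - P x + R x) := by
  rw [Finset.sum_add_distrib, Finset.sum_sub_distrib, hP.2, hR.2, kl]; ring

lemma sq_norm_sub_le_kl {P R : Fin k → ℝ} (hP : P ∈ openSimplex k) (hR : R ∈ openSimplex k) :
    ‖P - R‖ ^ 2 / 4 ≤ kl P R := by
  have hterm (x) := sq_sub_div_four_le (hP.1 x) (le_one_of_mem_openSimplex hP x) (hR.1 x) (le_one_of_mem_openSimplex hR x)
  have hkl (x) : (P x - R x) ^ 2 / 4 ≤ kl P R := by
    rw [kl_eq_sum hP hR]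
    exact (hterm x).trans (Finset.single_le_sum
      (f := fun x => P x * Real.log (P x / R x) - P x + R x)
      (fun y _ => (by positivity : (0 : ℝ) ≤ (P y - R y) ^ 2 / 4).trans (hterm y))
      (Finset.mem_univ x))
  have hkl0 : 0 ≤ kl P R := by
    rw [kl_eq_sum hP hR]
    exact Finset.sum_nonneg fun y _ =>
      (by positivity : (0 : ℝ) ≤ (P y - R y) ^ 2 / 4).trans (hterm y)
  have : ‖P - R‖ ≤ √(4 * kl P R) := by
    refine (pi_norm_le_iff_of_nonneg (Real.sqrt_nonneg _)).2 fun x => ?_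
    refine Real.le_sqrt_of_sq_le ?_
    rw [Real.norm_eq_abs, sq_abs, Pi.sub_apply]
    linarith [hkl x]
  have h2 := (Real.le_sqrt (norm_nonneg _) (by positivity)).1 this
  linarith

lemma kl_nonneg {P R : Fin k → ℝ} (hP : P ∈ openSimplex k) (hR : R ∈ openSimplex k) :
    0 ≤ kl P R :=
  (by positivity : (0 : ℝ) ≤ ‖P - R‖ ^ 2 / 4).trans (sq_norm_sub_le_kl hP hR)

lemma kl_le_sq_norm_sub {P R : Fin k → ℝ} (hP : P ∈ openSimplex k) (hR : R ∈ openSimplex k)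
    {δ : ℝ} (hδ : 0 < δ) (hRδ : ∀ x, δ ≤ R x) :
    kl P R ≤ k / δ * ‖P - R‖ ^ 2 := by
  rw [kl_eq_sum hP hR]
  have : ∀ x ∈ Finset.univ, P x * Real.log (P x / R x) - P x + R x ≤ ‖P - R‖ ^ 2 / δ := by
    intro x _
    refine (mul_log_div_sub_add_le (hP.1 x) (hR.1 x)).trans ?_
    refine div_le_div₀ (by positivity) ?_ hδ (hRδ x)
    have := norm_le_pi_norm (P - R) x
    rw [Real.norm_eq_abs, Pi.sub_apply] at this
    exact sq_le_sq' (by linarith [neg_abs_le (P x - R x)]) ((le_abs_self _).trans this)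
  refine (Finset.sum_le_sum this).trans (le_of_eq ?_)
  simp; ring

/-! ### Existence of the information projection and its first-order condition. -/

lemma exists_pos_le {P : Fin k → ℝ} (hP : ∀ x, 0 < P x) : ∃ δ > 0, ∀ x, δ ≤ P x := by
  rcases isEmpty_or_nonempty (Fin k) with _ | _
  · exact ⟨1, one_pos, fun x => isEmptyElim x⟩
  · obtain ⟨x, hx⟩ := Finite.exists_min P
    exact ⟨P x, hP x, hx⟩

/-- The constraint on strictly positive laws, relaxed to nonnegative ones, is compact. -/
lemma isCompact_closedFeasible (h : Fin k → EuclideanSpace ℝ (Fin d))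
    (a : EuclideanSpace ℝ (Fin d)) :
    IsCompact {P : Fin k → ℝ | (∀ x, 0 ≤ P x) ∧ ∑ x, P x = 1 ∧ ∑ x, P x • h x = a} := by
  have hc : IsClosed {P : Fin k → ℝ | ∑ x, P x • h x = a} :=
    isClosed_eq (by fun_prop) continuous_const
  refine ((isCompact_stdSimplex ℝ (Fin k)).inter_right hc).of_isClosed_subset ?_ ?_
  · simp only [Set.ofPred_and, Set.ofPred_forall]
    exact (isClosed_iInter fun x => isClosed_le continuous_const (continuous_apply x)).inter
      ((isClosed_eq (by fun_prop) continuous_const).inter hc)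
  · exact fun P hP => ⟨⟨hP.1, hP.2.1⟩, hP.2.2⟩

lemma mul_log_div {Q : ℝ} (hQ : 0 < Q) (t : ℝ) :
    t * Real.log (t / Q) = t * Real.log t - t * Real.log Q := by
  rcases eq_or_ne t 0 with rfl | ht
  · simp
  · rw [Real.log_div ht hQ.ne']; ring

lemma continuous_kl {Q : Fin k → ℝ} (hQ : ∀ x, 0 < Q x) : Continuous fun P => kl P Q := by
  simp only [kl, mul_log_div (hQ _)]
  refine continuous_finsetSum _ fun x _ => ?_
  exact (Real.continuous_mul_log.comp (continuous_apply x)).sub (by fun_prop)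

lemma mul_log_div_convexComb_le {Q u r t : ℝ} (hQ : 0 < Q) (hu : 0 ≤ u) (hr : 0 ≤ r)
    (ht0 : 0 ≤ t) (ht1 : t ≤ 1) :
    ((1 - t) * u + t * r) * Real.log (((1 - t) * u + t * r) / Q) ≤
      (1 - t) * (u * Real.log (u / Q)) + t * (r * Real.log (r / Q)) := by
  have := Real.convexOn_mul_log.2 (Set.mem_Ici.2 hu) (Set.mem_Ici.2 hr)
    (sub_nonneg.2 ht1) ht0 (by ring)
  simp only [smul_eq_mul] at this
  simp only [mul_log_div hQ]
  linarith

/-- Compactness gives a minimizer among nonnegative laws. It cannot vanish anywhere: moving towards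
a strictly positive feasible `R` changes the divergence with slope `-∞` at a zero coordinate,
because of `t log t`. -/
lemma exists_isMinOn_kl {Q : Fin k → ℝ} (hQ : Q ∈ openSimplex k)
    {h : Fin k → EuclideanSpace ℝ (Fin d)} {a : EuclideanSpace ℝ (Fin d)}
    (ha : (feasible h a).Nonempty) :
    ∃ P ∈ feasible h a, IsMinOn (fun P => kl P Q) (feasible h a) P := by
  obtain ⟨R, hR⟩ := ha
  set S := {P : Fin k → ℝ | (∀ x, 0 ≤ P x) ∧ ∑ x, P x = 1 ∧ ∑ x, P x • h x = a} with hS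
  have hsub : feasible h a ⊆ S := fun P hP => ⟨fun x => (hP.1.1 x).le, hP.1.2, hP.2⟩
  obtain ⟨P, hPS, hmin⟩ := (isCompact_closedFeasible h a).exists_isMinOn ⟨R, hsub hR⟩
    (continuous_kl hQ.1).continuousOn
  refine ⟨P, ⟨⟨fun z => ?_, hPS.2.1⟩, hPS.2.2⟩, hmin.on_subset hsub⟩
  by_contra hz
  have hz : P z = 0 := le_antisymm (not_lt.1 hz) (hPS.1 z)
  have key (t : ℝ) (ht0 : 0 < t) (ht1 : t ≤ 1) :
      kl P Q ≤ (1 - t) * kl P Q + t * kl R Q + t * Real.log t * R z := by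
    have hmem : (fun x => (1 - t) * P x + t * R x) ∈ S := by
      refine ⟨fun x => ?_, ?_, ?_⟩
      · have := hPS.1 x; have := hR.1.1 x; have := sub_nonneg.2 ht1; positivity
      · rw [Finset.sum_add_distrib, ← Finset.mul_sum, ← Finset.mul_sum, hPS.2.1, hR.1.2]; ring
      · simp only [add_smul, mul_smul, Finset.sum_add_distrib, ← Finset.smul_sum, hPS.2.2, hR.2]
        rw [← add_smul]; simp
    refine (hmin hmem).trans ?_
    have hterm : ∀ x ∈ Finset.univ, ((1 - t) * P x + t * R x) *
          Real.log (((1 - t) * P x + t * R x) / Q x) ≤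
        (1 - t) * (P x * Real.log (P x / Q x)) + t * (R x * Real.log (R x / Q x))
          + if x = z then t * Real.log t * R z else 0 := by
      intro x _
      split_ifs with hx
      · subst hx
        rw [hz, mul_zero, zero_add, mul_div_assoc,
          Real.log_mul ht0.ne' (div_pos (hR.1.1 x) (hQ.1 x)).ne']
        apply le_of_eq; ring
      · rw [add_zero]
        exact mul_log_div_convexComb_le (hQ.1 x) (hPS.1 x) (hR.1.1 x).le ht0.le ht1
    refine (Finset.sum_le_sum hterm).trans (le_of_eq ?_)
    simp [kl, Finset.sum_add_distrib, Finset.mul_sum]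
  have hRz := hR.1.1 z
  -- At `t = exp (-b)` the term `t * log t * R z` equals `-t * b * R z`; this `b` makes `b * R z`
  -- exceed `kl R Q - kl P Q`, contradicting `key`.
  set b := |kl R Q - kl P Q| / R z + 1
  have hb : 0 < b := by positivity
  have h1 := key (Real.exp (-b)) (Real.exp_pos _) (Real.exp_le_one_iff.2 (by linarith))
  rw [Real.log_exp] at h1
  have h2 : 0 ≤ Real.exp (-b) * (kl R Q - kl P Q - b * R z) := by linarith
  have h3 := nonneg_of_mul_nonneg_right h2 (Real.exp_pos _)
  have h4 : b * R z = |kl R Q - kl P Q| + R z := by simp only [b]; field_simp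
  linarith [le_abs_self (kl R Q - kl P Q)]

lemma infoProj_spec {Q : Fin k → ℝ} (hQ : Q ∈ openSimplex k)
    {h : Fin k → EuclideanSpace ℝ (Fin d)} {a : EuclideanSpace ℝ (Fin d)}
    (ha : (feasible h a).Nonempty) :
    infoProj Q h a ∈ feasible h a ∧
      IsMinOn (fun P => kl P Q) (feasible h a) (infoProj Q h a) := by
  have H := exists_isMinOn_kl hQ ha
  rw [infoProj, dif_pos H]
  exact H.choose_spec

lemma infoProj_mem_openSimplex {Q : Fin k → ℝ} (hQ : Q ∈ openSimplex k)
    (h : Fin k → EuclideanSpace ℝ (Fin d)) (a : EuclideanSpace ℝ (Fin d)) :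
    infoProj Q h a ∈ openSimplex k := by
  by_cases H : ∃ P ∈ feasible h a, IsMinOn (fun P => kl P Q) (feasible h a) P
  · rw [infoProj, dif_pos H]; exact H.choose_spec.1.1
  · rw [infoProj, dif_neg H]; exact hQ

/-- First-order condition: the log-density of the projection annihilates the tangent space. -/
lemma sum_mul_log_infoProj_eq_zero {Q : Fin k → ℝ} (hQ : Q ∈ openSimplex k)
    {h : Fin k → EuclideanSpace ℝ (Fin d)} {a : EuclideanSpace ℝ (Fin d)}
    (ha : (feasible h a).Nonempty) {v : Fin k → ℝ} (hv : ∑ x, v x = 0)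
    (hv' : ∑ x, v x • h x = 0) :
    ∑ x, v x * Real.log (infoProj Q h a x / Q x) = 0 := by
  obtain ⟨hP, hmin⟩ := infoProj_spec hQ ha
  set P := infoProj Q h a
  -- Strict positivity of `P` allows small moves of both signs along `v`, so the derivative vanishes
  -- rather than merely having a sign.
  have hmem : ∀ᶠ t : ℝ in 𝓝 0, (fun x => P x + t * v x) ∈ feasible h a := by
    have hpos : ∀ᶠ t : ℝ in 𝓝 0, ∀ x, 0 < P x + t * v x := by
      refine eventually_all.2 fun x => ?_
      have hc : Continuous fun t : ℝ => P x + t * v x := by fun_prop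
      exact hc.continuousAt.eventually_const_lt (by simpa using hP.1.1 x)
    filter_upwards [hpos] with t ht
    refine ⟨⟨ht, ?_⟩, ?_⟩
    · rw [Finset.sum_add_distrib, ← Finset.mul_sum, hv, hP.1.2]; ring
    · simp only [add_smul, mul_smul, Finset.sum_add_distrib, ← Finset.smul_sum, hP.2, hv']
      simp
  have hloc : IsLocalMin (fun t : ℝ => kl (fun x => P x + t * v x) Q) 0 := by
    filter_upwards [hmem] with t ht
    simpa using hmin ht
  have hder : HasDerivAt (fun t : ℝ => kl (fun x => P x + t * v x) Q)
      (∑ x, (v x * Real.log (P x / Q x) + v x)) 0 := by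
    refine HasDerivAt.fun_sum fun x _ => ?_
    have h1 : HasDerivAt (fun t : ℝ => P x + t * v x) (v x) 0 := by
      simpa using ((hasDerivAt_id (0 : ℝ)).mul_const (v x)).const_add (P x)
    have hPx := hP.1.1 x
    have hQx := hQ.1 x
    have h2 := h1.mul ((h1.div_const (Q x)).log (by simp; constructor <;> positivity))
    refine h2.congr_deriv ?_
    rw [zero_mul, add_zero]
    field_simp
  have := hloc.hasDerivAt_eq_zero hder
  rwa [Finset.sum_add_distrib, hv, add_zero] at this

/-- No positivity of `R` or `S` is needed, so this applies to empirical measures. -/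
lemma sum_mul_log_infoProj_congr {Q : Fin k → ℝ} (hQ : Q ∈ openSimplex k)
    {h : Fin k → EuclideanSpace ℝ (Fin d)} {a : EuclideanSpace ℝ (Fin d)}
    (ha : (feasible h a).Nonempty) {R S : Fin k → ℝ} (hRS : ∑ x, R x = ∑ x, S x)
    (hRS' : ∑ x, R x • h x = ∑ x, S x • h x) :
    ∑ x, R x * Real.log (infoProj Q h a x / Q x) =
      ∑ x, S x * Real.log (infoProj Q h a x / Q x) := by
  have := sum_mul_log_infoProj_eq_zero hQ ha (v := fun x => R x - S x)
    (by simp [hRS]) (by simp [sub_smul, hRS'])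
  simp only [sub_mul, Finset.sum_sub_distrib] at this
  linarith

/-! ### Stability of the projection under changes of the moments. -/

/-- The map to mass and moments has a linear right inverse on its range, bounded by finite
dimensionality. Passing to the range avoids any independence assumption on the features. -/
lemma exists_bounded_lift (h : Fin k → EuclideanSpace ℝ (Fin d)) :
    ∃ C ≥ 0, ∀ v : Fin k → ℝ, ∑ x, v x = 0 → ∃ w : Fin k → ℝ, ∑ x, w x = 0 ∧
      ∑ x, w x • h x = ∑ x, v x • h x ∧ ‖w‖ ≤ C * ‖∑ x, v x • h x‖ := by
  let B : (Fin k → ℝ) →ₗ[ℝ] ℝ × EuclideanSpace ℝ (Fin d) :=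
    LinearMap.prod (Fintype.linearCombination ℝ fun _ : Fin k => (1 : ℝ))
      (Fintype.linearCombination ℝ h)
  obtain ⟨g, hg⟩ := B.rangeRestrict.exists_rightInverse_of_surjective B.range_rangeRestrict
  obtain ⟨C, hC, hgC⟩ := (LinearMap.toContinuousLinearMap g).bound
  refine ⟨C, hC.le, fun v hv => ?_⟩
  have hB (u : Fin k → ℝ) : B u = (∑ x, u x, ∑ x, u x • h x) := by
    simp [B, Fintype.linearCombination_apply]
  have e : B (g (B.rangeRestrict v)) = B v :=
    congrArg Subtype.val (LinearMap.congr_fun hg (B.rangeRestrict v))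
  rw [hB, hB, Prod.mk.injEq] at e
  refine ⟨g (B.rangeRestrict v), e.1.trans hv, e.2, ?_⟩
  have hn : ‖B.rangeRestrict v‖ = ‖∑ x, v x • h x‖ := by
    rw [Submodule.coe_norm]
    change ‖B v‖ = _
    rw [hB]
    simp [Prod.norm_def, hv]
  rw [← hn]
  exact hgC _

/-- A signed law whose moments are close to those of `P` shares them with a law near `P`. -/
lemma exists_openSimplex_near (h : Fin k → EuclideanSpace ℝ (Fin d)) {P : Fin k → ℝ}
    (hP : P ∈ openSimplex k) :
    ∃ C ≥ 0, ∃ ρ > 0, ∀ R : Fin k → ℝ, ∑ x, R x = 1 →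
      ‖∑ x, R x • h x - ∑ x, P x • h x‖ < ρ →
      ∃ S ∈ openSimplex k, ∑ x, S x • h x = ∑ x, R x • h x ∧
        ‖S - P‖ ≤ C * ‖∑ x, R x • h x - ∑ x, P x • h x‖ := by
  obtain ⟨C, hC, hlift⟩ := exists_bounded_lift h
  obtain ⟨δ, hδ, hPδ⟩ := exists_pos_le hP.1
  refine ⟨C, hC, δ / (C + 1), by positivity, fun R hR hRρ => ?_⟩
  obtain ⟨w, hw, hw', hwn⟩ := hlift (fun x => R x - P x) (by simp [hR, hP.2])
  have e : ∑ x, (R x - P x) • h x = ∑ x, R x • h x - ∑ x, P x • h x := by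
    simp [sub_smul]
  rw [e] at hw' hwn
  have hwδ : ‖w‖ < δ := by
    refine hwn.trans_lt ?_
    rw [lt_div_iff₀ (by positivity)] at hRρ
    nlinarith [norm_nonneg (∑ x, R x • h x - ∑ x, P x • h x)]
  refine ⟨P + w, ⟨fun x => ?_, ?_⟩, ?_, by simpa using hwn⟩
  · have := norm_le_pi_norm w x
    rw [Real.norm_eq_abs] at this
    simp only [Pi.add_apply]
    linarith [hPδ x, neg_abs_le (w x)]
  · simp [Finset.sum_add_distrib, hw, hP.2]
  · simp [add_smul, Finset.sum_add_distrib, hw']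

/-- The information projection is pointwise Lipschitz in the moment constraint. -/
lemma exists_infoProj_lipschitz {Q : Fin k → ℝ} (hQ : Q ∈ openSimplex k)
    {h : Fin k → EuclideanSpace ℝ (Fin d)} {a₀ : EuclideanSpace ℝ (Fin d)}
    (ha₀ : (feasible h a₀).Nonempty) :
    ∃ C ≥ 0, ∃ ρ > 0, ∀ a, (feasible h a).Nonempty → ‖a - a₀‖ < ρ →
      ‖infoProj Q h a - infoProj Q h a₀‖ ≤ C * ‖a - a₀‖ := by
  have hP₀ := (infoProj_spec hQ ha₀).1
  obtain ⟨C, hC, ρ, hρ, hnear⟩ := exists_openSimplex_near h hP₀.1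
  obtain ⟨δ, hδ, hPδ⟩ := exists_pos_le hP₀.1.1
  -- The constant comes from `‖P - P₀‖² / 4 ≤ kl P P₀ ≤ kl S P₀ ≤ k / δ * (C * ‖a - a₀‖)²`.
  refine ⟨√(4 * (k / δ) * C ^ 2), Real.sqrt_nonneg _, ρ, hρ, fun a ha haρ => ?_⟩
  have hPa := (infoProj_spec hQ ha).1
  obtain ⟨S, hS, hSa, hSn⟩ := hnear (infoProj Q h a) hPa.1.2 (by rwa [hPa.2, hP₀.2])
  rw [hPa.2, hP₀.2] at hSn
  rw [hPa.2] at hSa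
  set P := infoProj Q h a
  set P₀ := infoProj Q h a₀
  have h1 := sum_mul_log_infoProj_congr hQ ha (R := P) (S := S)
    (by rw [hPa.1.2, hS.2]) (by rw [hPa.2, hSa])
  have h2 := sum_mul_log_infoProj_congr hQ ha₀ (R := P) (S := S)
    (by rw [hPa.1.2, hS.2]) (by rw [hPa.2, hSa])
  have hle : kl P P₀ ≤ kl S P₀ := by
    -- A Pythagorean identity: `log (P / P₀)` has the same mean under `P` and `S`, which share their
    -- moments.
    have hsplit : kl P P₀ = kl S P₀ - kl S P := by
      have e1 : kl P P₀ = ∑ x, P x * Real.log (P x / Q x) - ∑ x, P x * Real.log (P₀ x / Q x) := by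
        rw [kl, ← Finset.sum_sub_distrib]
        refine Finset.sum_congr rfl fun x _ => ?_
        have := hQ.1 x; have := hPa.1.1 x; have := hP₀.1.1 x
        rw [Real.log_div, Real.log_div, Real.log_div] <;> first | positivity | ring
      have e2 : kl S P₀ - kl S P =
          ∑ x, S x * Real.log (P x / Q x) - ∑ x, S x * Real.log (P₀ x / Q x) := by
        rw [kl, kl, ← Finset.sum_sub_distrib, ← Finset.sum_sub_distrib]
        refine Finset.sum_congr rfl fun x _ => ?_
        have := hQ.1 x; have := hPa.1.1 x; have := hP₀.1.1 x; have := hS.1 x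
        rw [Real.log_div, Real.log_div, Real.log_div, Real.log_div] <;> first | positivity | ring
      rw [e1, e2, h1, h2]
    linarith [kl_nonneg hS hPa.1]
  have h3 := sq_norm_sub_le_kl hPa.1 hP₀.1
  have h4 := kl_le_sq_norm_sub hS hP₀.1 hδ hPδ
  have h5 : ‖S - P₀‖ ^ 2 ≤ (C * ‖a - a₀‖) ^ 2 := by gcongr
  have h6 := mul_le_mul_of_nonneg_left h5 (by positivity : (0 : ℝ) ≤ k / δ)
  rw [← Real.sqrt_sq (norm_nonneg (a - a₀)), ← Real.sqrt_mul (by positivity)]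
  refine Real.le_sqrt_of_sq_le ?_
  nlinarith

lemma continuousOn_infoProj {Q : Fin k → ℝ} (hQ : Q ∈ openSimplex k)
    (h : Fin k → EuclideanSpace ℝ (Fin d)) :
    ContinuousOn (infoProj Q h) {a | (feasible h a).Nonempty} := by
  intro a₀ ha₀
  obtain ⟨C, hC, ρ, hρ, hL⟩ := exists_infoProj_lipschitz hQ ha₀
  rw [ContinuousWithinAt, tendsto_iff_norm_sub_tendsto_zero]
  have hlim : Tendsto (fun a => C * ‖a - a₀‖) (𝓝[{a | (feasible h a).Nonempty}] a₀) (𝓝 0) := by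
    have : Continuous fun a => C * ‖a - a₀‖ := by fun_prop
    exact tendsto_nhdsWithin_of_tendsto_nhds (by simpa using this.tendsto a₀)
  refine squeeze_zero' (Eventually.of_forall fun _ => norm_nonneg _) ?_ hlim
  filter_upwards [self_mem_nhdsWithin, mem_nhdsWithin_of_mem_nhds (Metric.ball_mem_nhds a₀ hρ)]
    with a ha haρ
  exact hL a ha (by simpa [dist_eq_norm] using haρ)

/-! ### Positivity of the curvature. -/

lemma inner_projHessian (h : Fin k → EuclideanSpace ℝ (Fin d)) (P : Fin k → ℝ)
    (v w : tangentSpace h) :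
    inner ℝ (projHessian h P v) w = ∑ x, 1 / P x * (v : EuclideanSpace ℝ (Fin k)) x *
      (w : EuclideanSpace ℝ (Fin k)) x := by
  have : inner ℝ (projHessian h P v) w =
      inner ℝ (Matrix.toEuclideanLin (Matrix.diagonal fun x => 1 / P x)
        (v : EuclideanSpace ℝ (Fin k))) (w : EuclideanSpace ℝ (Fin k)) :=
    Submodule.inner_orthogonalProjectionOnto_eq_of_mem_right w _
  rw [this, PiLp.inner_apply]
  refine Finset.sum_congr rfl fun x _ => ?_
  simp [Matrix.toLpLin_apply, Matrix.mulVec_diagonal]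
  ring

/-- Since `1 / P x ≥ 1`, every eigenvalue is at least `1`. Nontriviality of the tangent space
matters: the infimum of an empty spectrum would be the default value `0`. -/
lemma curvature_pos {h : Fin k → EuclideanSpace ℝ (Fin d)} (hT : tangentSpace h ≠ ⊥)
    {P : Fin k → ℝ} (hP : P ∈ openSimplex k) : 0 < curvature h P := by
  have : Nontrivial (tangentSpace h) := Submodule.nontrivial_iff_ne_bot.2 hT
  have hsymm : (projHessian h P).IsSymmetric := by
    intro v w
    rw [inner_projHessian, real_inner_comm, inner_projHessian]
    exact Finset.sum_congr rfl fun x _ => by ring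
  refine one_pos.trans_le (le_csInf ⟨_, hsymm.hasEigenvalue_iInf_of_finiteDimensional⟩ ?_)
  intro μ hμ
  obtain ⟨v, hv⟩ := hμ.exists_hasEigenvector
  have hv0 : 0 < inner ℝ v v := real_inner_self_pos.2 hv.2
  have h1 : inner ℝ (projHessian h P v) v = μ * inner ℝ v v := by
    rw [hv.apply_eq_smul, real_inner_smul_left]
  have h2 : inner ℝ v v ≤ inner ℝ (projHessian h P v) v := by
    rw [inner_projHessian, Submodule.coe_inner, PiLp.inner_apply]
    refine Finset.sum_le_sum fun x _ => ?_
    have hx : 1 ≤ 1 / P x := one_le_one_div (hP.1 x) (le_one_of_mem_openSimplex hP x)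
    have := mul_le_mul_of_nonneg_right hx (mul_self_nonneg ((v : EuclideanSpace ℝ (Fin k)) x))
    rw [one_mul, ← mul_assoc] at this
    exact this
  nlinarith

/-! ### Empirical measures and the form of the likelihood. -/

lemma sum_empirical {n : ℕ} (hn : n ≠ 0) (x : Fin n → Fin k) : ∑ y, empirical x y = 1 := by
  have h := Finset.card_eq_sum_card_fiberwise (f := x) (s := Finset.univ) (t := Finset.univ)
    (by simp)
  simp only [empirical, ← Finset.sum_div]
  rw [← Nat.cast_sum, ← h]
  simp [hn]

lemma empirical_apply {n : ℕ} (x : Fin n → Fin k) (y : Fin k) :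
    empirical x y = (∑ i, if x i = y then (1 : ℝ) else 0) / n := by
  simp [empirical]

lemma sum_comp_eq_sum_empirical {n : ℕ} (hn : n ≠ 0) (x : Fin n → Fin k) (g : Fin k → ℝ) :
    ∑ i, g (x i) = n * ∑ y, empirical x y * g y := by
  have hn' : (n : ℝ) ≠ 0 := by exact_mod_cast hn
  rw [← Finset.sum_fiberwise_of_maps_to (s := Finset.univ) (t := Finset.univ) (g := x)
    (f := fun i => g (x i)) (by simp), Finset.mul_sum]
  refine Finset.sum_congr rfl fun y _ => ?_
  rw [Finset.sum_congr rfl (g := fun _ => g y) (by simp +contextual), Finset.sum_const,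
    empirical, nsmul_eq_mul]
  field_simp

/-- The likelihood as a function of the parameter, for a sample whose moments are those of `S`. -/
lemma exists_iidLaw_infoProj_eq {Q : Fin k → ℝ} (hQ : Q ∈ openSimplex k)
    {h : Fin k → EuclideanSpace ℝ (Fin d)} {n : ℕ} (hn : n ≠ 0) (x : Fin n → Fin k)
    {S : Fin k → ℝ} (hS : S ∈ openSimplex k)
    (hSx : ∑ y, S y • h y = ∑ y, empirical x y • h y) :
    ∃ D > 0, ∀ a, (feasible h a).Nonempty →
      iidLaw (infoProj Q h a) n x = D * Real.exp (-(n * kl S (infoProj Q h a))) := by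
  refine ⟨Real.exp (n * (∑ y, empirical x y * Real.log (Q y) +
    ∑ y, S y * Real.log (S y / Q y))), Real.exp_pos _, fun a ha => ?_⟩
  have hP := (infoProj_spec hQ ha).1.1
  have hc := sum_mul_log_infoProj_congr hQ ha (R := S) (S := empirical x)
    (by rw [hS.2, sum_empirical hn]) hSx
  set P := infoProj Q h a
  have h1 : iidLaw P n x = Real.exp (∑ i, Real.log (P (x i))) := by
    rw [Real.exp_sum]
    exact Finset.prod_congr rfl fun i _ => (Real.exp_log (hP.1 _)).symm
  have h2 : ∑ y, empirical x y * Real.log (P y) = ∑ y, empirical x y * Real.log (P y / Q y) +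
      ∑ y, empirical x y * Real.log (Q y) := by
    rw [← Finset.sum_add_distrib]
    refine Finset.sum_congr rfl fun y _ => ?_
    rw [Real.log_div (hP.1 y).ne' (hQ.1 y).ne']; ring
  have h3 : kl S P = ∑ y, S y * Real.log (S y / Q y) - ∑ y, S y * Real.log (P y / Q y) := by
    rw [kl, ← Finset.sum_sub_distrib]
    refine Finset.sum_congr rfl fun y _ => ?_
    have := hP.1 y; have := hQ.1 y; have := hS.1 y
    rw [Real.log_div, Real.log_div, Real.log_div] <;> first | positivity | ring
  rw [h1, sum_comp_eq_sum_empirical hn x (fun y => Real.log (P y)), h2, h3, hc, ← Real.exp_add]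
  congr 1
  ring

/-! ### Product laws. -/

lemma iidLaw_pos {P : Fin k → ℝ} (hP : P ∈ openSimplex k) (m : ℕ) (y : Fin m → Fin k) :
    0 < iidLaw P m y := Finset.prod_pos fun _ _ => hP.1 _

lemma iidLaw_le_one {P : Fin k → ℝ} (hP : P ∈ openSimplex k) (m : ℕ) (y : Fin m → Fin k) :
    iidLaw P m y ≤ 1 :=
  Finset.prod_le_one (fun _ _ => (hP.1 _).le) fun _ _ => le_one_of_mem_openSimplex hP _

lemma sum_iidLaw {P : Fin k → ℝ} (hP : P ∈ openSimplex k) (m : ℕ) :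
    ∑ y, iidLaw P m y = 1 := by
  simp only [iidLaw]
  rw [← Fintype.prod_sum (fun (_ : Fin m) (x : Fin k) => P x)]
  simp [hP.2]

lemma sum_fin_succ_pi {M : Type*} [AddCommMonoid M] (m : ℕ) (F : (Fin (m + 1) → Fin k) → M) :
    ∑ y, F y = ∑ z, ∑ y, F (Fin.cons z y) := by
  rw [← (Fin.consEquiv fun _ : Fin (m + 1) => Fin k).sum_comp, Fintype.sum_prod_type]
  rfl

/-- The `ℓ¹` distance is subadditive under products. -/
lemma sum_abs_iidLaw_sub_le {P R : Fin k → ℝ} (hP : P ∈ openSimplex k) (hR : R ∈ openSimplex k)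
    (m : ℕ) : ∑ y, |iidLaw P m y - iidLaw R m y| ≤ m * ∑ x, |P x - R x| := by
  induction m with
  | zero => simp [iidLaw]
  | succ m ih =>
    have hterm (z : Fin k) (y : Fin m → Fin k) :
        |iidLaw P (m + 1) (Fin.cons z y) - iidLaw R (m + 1) (Fin.cons z y)| ≤
          P z * |iidLaw P m y - iidLaw R m y| + |P z - R z| * iidLaw R m y := by
      have e (S : Fin k → ℝ) : iidLaw S (m + 1) (Fin.cons z y) = S z * iidLaw S m y := by
        simp [iidLaw, Fin.prod_univ_succ]
      rw [e, e]
      calc _ = |P z * (iidLaw P m y - iidLaw R m y) + (P z - R z) * iidLaw R m y| := by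
            congr 1; ring
        _ ≤ _ := by
          refine (abs_add_le _ _).trans (le_of_eq ?_)
          rw [abs_mul, abs_mul, abs_of_pos (hP.1 z), abs_of_pos (iidLaw_pos hR m y)]
    rw [sum_fin_succ_pi]
    refine (Finset.sum_le_sum fun z _ => Finset.sum_le_sum fun y _ => hterm z y).trans ?_
    simp only [Finset.sum_add_distrib, ← Finset.mul_sum, ← Finset.sum_mul, hP.2,
      sum_iidLaw hR, one_mul, mul_one]
    push_cast
    linarith

lemma sum_abs_sub_le_norm (P R : Fin k → ℝ) : ∑ x, |P x - R x| ≤ k * ‖P - R‖ := by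
  refine (Finset.sum_le_sum fun x _ => norm_le_pi_norm (P - R) x).trans ?_
  simp

lemma norm_sub_le_one {P R : Fin k → ℝ} (hP : P ∈ openSimplex k) (hR : R ∈ openSimplex k) :
    ‖P - R‖ ≤ 1 := by
  refine (pi_norm_le_iff_of_nonneg zero_le_one).2 fun x => ?_
  rw [Real.norm_eq_abs, Pi.sub_apply, abs_le]
  have := hP.1 x; have := hR.1 x
  have := le_one_of_mem_openSimplex hP x; have := le_one_of_mem_openSimplex hR x
  constructor <;> linarith

/-! ### The posterior and predictive laws. -/

section Prior

variable {Q : Fin k → ℝ} {h : Fin k → EuclideanSpace ℝ (Fin d)}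
  {α : EuclideanSpace ℝ (Fin p) → EuclideanSpace ℝ (Fin d)}
  {prior : Measure (EuclideanSpace ℝ (Fin p))}

lemma aemeasurable_infoProj (hQ : Q ∈ openSimplex k) {Θ : Set (EuclideanSpace ℝ (Fin p))}
    (hΘ : MeasurableSet Θ) (hα : ContinuousOn α Θ) (hfeas : ∀ θ ∈ Θ, (feasible h (α θ)).Nonempty)
    (hprior : prior Θᶜ = 0) : AEMeasurable (fun θ => infoProj Q h (α θ)) prior := by
  have hc : ContinuousOn (fun θ => infoProj Q h (α θ)) Θ :=
    (continuousOn_infoProj hQ h).comp hα hfeas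
  have := hc.aemeasurable (μ := prior) hΘ
  rwa [Measure.restrict_eq_self_of_ae_mem (by exact hprior)] at this

lemma aemeasurable_iidLaw (hP : AEMeasurable (fun θ => infoProj Q h (α θ)) prior) (n : ℕ)
    (x : Fin n → Fin k) : AEMeasurable (fun θ => iidLaw (infoProj Q h (α θ)) n x) prior := by
  have : Measurable fun P : Fin k → ℝ => iidLaw P n x := by unfold iidLaw; fun_prop
  exact this.comp_aemeasurable hP

lemma isProbabilityMeasure_posterior [IsProbabilityMeasure prior] (hQ : Q ∈ openSimplex k)
    (hP : AEMeasurable (fun θ => infoProj Q h (α θ)) prior) {n : ℕ} (x : Fin n → Fin k) :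
    IsProbabilityMeasure (posterior Q h α prior x) := by
  have hmem (θ) := infoProj_mem_openSimplex hQ h (α θ)
  refine ⟨?_⟩
  rw [posterior, Measure.smul_apply, withDensity_apply _ MeasurableSet.univ, setLIntegral_univ,
    smul_eq_mul]
  refine ENNReal.inv_mul_cancel ?_ ?_
  · rw [Ne, lintegral_eq_zero_iff' (aemeasurable_iidLaw hP n x).ennreal_ofReal]
    intro h0
    obtain ⟨θ, hθ⟩ := h0.exists
    simp only [Pi.zero_apply, ENNReal.ofReal_eq_zero] at hθ
    exact absurd (iidLaw_pos (hmem θ) n x) (not_lt.2 hθ)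
  · refine ((lintegral_mono (g := fun _ => 1) fun θ => ?_).trans_lt ?_).ne
    · exact ENNReal.ofReal_le_one.2 (iidLaw_le_one (hmem θ) n x)
    · simp

lemma posterior_absolutelyContinuous {n : ℕ} (x : Fin n → Fin k) :
    posterior Q h α prior x ≪ prior :=
  (Measure.smul_absolutelyContinuous).trans (withDensity_absolutelyContinuous _ _)

/-- Bound of the posterior mass of `A` by the ratio of the likelihoods on `A` and on `B`. -/
lemma posterior_le_of_iidLaw_le [IsProbabilityMeasure prior] {n : ℕ} (x : Fin n → Fin k)
    {A B : Set (EuclideanSpace ℝ (Fin p))} (hA : MeasurableSet A) (hB : MeasurableSet B)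
    {u l b : ℝ} (hl : 0 < l) (hb : 0 < b)
    (hu : ∀ᵐ θ ∂prior, θ ∈ A → iidLaw (infoProj Q h (α θ)) n x ≤ u)
    (hl' : ∀ θ ∈ B, l ≤ iidLaw (infoProj Q h (α θ)) n x)
    (hB' : ENNReal.ofReal b ≤ prior B) :
    posterior Q h α prior x A ≤ ENNReal.ofReal (u / (l * b)) := by
  have hnum : ∫⁻ θ in A, ENNReal.ofReal (iidLaw (infoProj Q h (α θ)) n x) ∂prior ≤
      ENNReal.ofReal u := by
    calc _ ≤ ∫⁻ _ in A, ENNReal.ofReal u ∂prior :=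
          setLIntegral_mono_ae measurable_const.aemeasurable
            (hu.mono fun θ hθ hθA => ENNReal.ofReal_le_ofReal (hθ hθA))
      _ ≤ _ := by
        rw [setLIntegral_const]
        exact mul_le_of_le_one_right' prob_le_one
  have hden : ENNReal.ofReal (l * b) ≤
      ∫⁻ θ, ENNReal.ofReal (iidLaw (infoProj Q h (α θ)) n x) ∂prior := by
    calc _ = ENNReal.ofReal l * ENNReal.ofReal b := ENNReal.ofReal_mul hl.le
      _ ≤ ENNReal.ofReal l * prior B := by gcongr
      _ = ∫⁻ _ in B, ENNReal.ofReal l ∂prior := (setLIntegral_const _ _).symm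
      _ ≤ ∫⁻ θ in B, ENNReal.ofReal (iidLaw (infoProj Q h (α θ)) n x) ∂prior :=
        setLIntegral_mono' hB fun θ hθ => ENNReal.ofReal_le_ofReal (hl' θ hθ)
      _ ≤ _ := setLIntegral_le_lintegral _ _
  rw [posterior, Measure.smul_apply, withDensity_apply _ hA, smul_eq_mul,
    ENNReal.ofReal_div_of_pos (by positivity), mul_comm, ← div_eq_mul_inv]
  exact ENNReal.div_le_div hnum hden

lemma integrable_iidLaw {μ : Measure (EuclideanSpace ℝ (Fin p))} [IsFiniteMeasure μ]
    (hQ : Q ∈ openSimplex k) (hP : AEMeasurable (fun θ => infoProj Q h (α θ)) μ)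
    (m : ℕ) (y : Fin m → Fin k) :
    Integrable (fun θ => iidLaw (infoProj Q h (α θ)) m y) μ := by
  refine Integrable.of_bound (aemeasurable_iidLaw hP m y).aestronglyMeasurable 1
    (Eventually.of_forall fun θ => ?_)
  have hmem := infoProj_mem_openSimplex hQ h (α θ)
  rw [Real.norm_eq_abs, abs_of_pos (iidLaw_pos hmem m y)]
  exact iidLaw_le_one hmem m y

/-- The difference on an event is the posterior integral of a difference of product laws;
subadditivity of `ℓ¹` gives the factor `m`, and comparison with the sup norm gives `k`. -/
lemma tvDist_predictive_le [IsProbabilityMeasure prior] (hQ : Q ∈ openSimplex k)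
    (hP : AEMeasurable (fun θ => infoProj Q h (α θ)) prior) {n : ℕ} (x : Fin n → Fin k) (m : ℕ)
    {P₀ : Fin k → ℝ} (hP₀ : P₀ ∈ openSimplex k) :
    tvDist (predictive Q h α prior x m) (iidLaw P₀ m) ≤
      m * (k * ∫ θ, ‖infoProj Q h (α θ) - P₀‖ ∂posterior Q h α prior x) := by
  have hprob := isProbabilityMeasure_posterior hQ hP x
  have hP' := hP.mono_ac (posterior_absolutelyContinuous (Q := Q) (h := h) (α := α) x)
  set ν := posterior Q h α prior x
  have hint (y) := integrable_iidLaw (μ := ν) hQ hP' m y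
  refine ciSup_le fun A => ?_
  have e : ∑ y ∈ A, predictive Q h α prior x m y - ∑ y ∈ A, iidLaw P₀ m y =
      ∫ θ, ∑ y ∈ A, (iidLaw (infoProj Q h (α θ)) m y - iidLaw P₀ m y) ∂ν := by
    rw [integral_finsetSum _ fun y _ => (hint y).sub' (integrable_const _),
      ← Finset.sum_sub_distrib]
    refine Finset.sum_congr rfl fun y _ => ?_
    rw [integral_sub (hint y) (integrable_const _)]
    simp [predictive, ν]
  rw [e, ← integral_const_mul, ← integral_const_mul]
  refine (abs_integral_le_integral_abs).trans (integral_mono_of_nonneg ?_ ?_ ?_)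
  · exact Eventually.of_forall fun θ => abs_nonneg _
  · refine Integrable.const_mul (Integrable.const_mul ?_ _) _
    refine Integrable.of_bound (C := 1) ?_ (Eventually.of_forall fun θ => ?_)
    · exact (hP'.sub_const P₀).norm.aestronglyMeasurable
    · rw [norm_norm]
      exact norm_sub_le_one (infoProj_mem_openSimplex hQ h (α θ)) hP₀
  · refine Eventually.of_forall fun θ => ?_
    refine (Finset.abs_sum_le_sum_abs _ _).trans ?_
    refine (Finset.sum_le_univ_sum_of_nonneg fun _ => abs_nonneg _).trans ?_
    refine (sum_abs_iidLaw_sub_le (infoProj_mem_openSimplex hQ h (α θ)) hP₀ m).trans ?_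
    exact mul_le_mul_of_nonneg_left (sum_abs_sub_le_norm _ _) (Nat.cast_nonneg m)

end Prior

/-! ### Almost sure deviations of the empirical measure. -/

section Deviation

variable {Ω : Type*} [MeasurableSpace Ω] {Pr : Measure Ω} [IsProbabilityMeasure Pr]
  {X : ℕ → Ω → Fin k}

/-- One-sided deviations of empirical sums, from Hoeffding's inequality and Borel-Cantelli. -/
lemma ae_eventually_sum_sub_lt (hX : ∀ i, Measurable (X i)) (hindep : iIndepFun X Pr)
    (g : Fin k → ℝ) {a : ℝ} (hg : ∀ y, g y ∈ Set.Icc a (a + 1)) :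
    ∀ᵐ ω ∂Pr, ∀ᶠ n : ℕ in atTop,
      ∑ i ∈ Finset.range n, (g (X i ω) - ∫ ω', g (X i ω') ∂Pr) < √(n * Real.log n) := by
  have hgm : Measurable g := measurable_of_finite g
  have hsub (i : ℕ) : HasSubgaussianMGF (fun ω => g (X i ω) - ∫ ω', g (X i ω') ∂Pr) (1 / 4) Pr := by
    have := hasSubgaussianMGF_of_mem_Icc (μ := Pr) (X := fun ω => g (X i ω)) (a := a) (b := a + 1)
      (hgm.comp (hX i)).aemeasurable (Eventually.of_forall fun ω => hg _)
    convert this using 1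
    simp
    norm_num
  have hind : iIndepFun (fun i ω => g (X i ω) - ∫ ω', g (X i ω') ∂Pr) Pr :=
    hindep.comp (fun i y => g y - ∫ ω', g (X i ω') ∂Pr) fun i => measurable_of_finite _
  have hbound (n : ℕ) : Pr {ω | √(n * Real.log n) ≤
      ∑ i ∈ Finset.range n, (g (X i ω) - ∫ ω', g (X i ω') ∂Pr)} ≤
      -- At `n = 0` the event is everything, while `1 / 0 ^ 2` is `0`. For other `n`, variance proxy
      -- `1 / 4` and deviation `√(n log n)` give exactly `n⁻²`, which is summable.
      if n = 0 then 1 else ENNReal.ofReal (1 / (n : ℝ) ^ 2) := by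
    split_ifs with hn
    · exact prob_le_one
    have hn' : (0 : ℝ) < n := by exact_mod_cast Nat.pos_of_ne_zero hn
    have hlog : 0 ≤ Real.log n := Real.log_natCast_nonneg n
    have := HasSubgaussianMGF.measure_sum_range_ge_le_of_iIndepFun hind (n := n)
      (fun i _ => hsub i) (Real.sqrt_nonneg (n * Real.log n))
    rw [← ofReal_measureReal]
    refine ENNReal.ofReal_le_ofReal (this.trans (le_of_eq ?_))
    rw [Real.sq_sqrt (by positivity)]
    have e : -(n * Real.log n) / (2 * n * ((1 / 4 : NNReal) : ℝ)) = -(Real.log n + Real.log n) := by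
      push_cast; field_simp; ring
    rw [e, Real.exp_neg, Real.exp_add, Real.exp_log hn', ← sq, one_div]
  have hsum : ∑' n : ℕ, Pr {ω | √(n * Real.log n) ≤
      ∑ i ∈ Finset.range n, (g (X i ω) - ∫ ω', g (X i ω') ∂Pr)} ≠ ⊤ := by
    have hs : Summable fun n : ℕ => 1 / (n : ℝ) ^ 2 :=
      Real.summable_one_div_nat_pow.2 one_lt_two
    refine ne_top_of_le_ne_top ?_ (ENNReal.tsum_le_tsum hbound)
    refine ne_top_of_le_ne_top (b := ∑' n : ℕ, ((if n = 0 then 1 else 0) +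
      ENNReal.ofReal (1 / (n : ℝ) ^ 2))) ?_ (ENNReal.tsum_le_tsum fun n => ?_)
    · rw [ENNReal.tsum_add, tsum_ite_eq]
      exact ENNReal.add_ne_top.2 ⟨ENNReal.one_ne_top, hs.tsum_ofReal_ne_top⟩
    · split_ifs <;> simp
  filter_upwards [ae_eventually_notMem hsum] with ω hω
  exact hω.mono fun n hn => not_le.1 hn

lemma ae_eventually_abs_empirical_sub_le (hX : ∀ i, Measurable (X i)) (hindep : iIndepFun X Pr)
    {P₀ : Fin k → ℝ} (hlaw : ∀ i x, Pr.real (X i ⁻¹' {x}) = P₀ x) :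
    ∀ᵐ ω ∂Pr, ∀ᶠ n : ℕ in atTop, ∀ y,
      |empirical (fun i : Fin n => X i ω) y - P₀ y| ≤ √(Real.log n / n) := by
  have hmean (i : ℕ) (y : Fin k) : ∫ ω, (if X i ω = y then (1 : ℝ) else 0) ∂Pr = P₀ y := by
    rw [← hlaw i y, ← integral_indicator_one (hX i (measurableSet_singleton y))]
    refine integral_congr_ae (Eventually.of_forall fun ω => ?_)
    dsimp only
    by_cases hy : X i ω = y
    · rw [if_pos hy, Set.indicator_of_mem (by exact hy), Pi.one_apply]
    · rw [if_neg hy, Set.indicator_of_notMem (by exact hy)]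
  have hup (y : Fin k) := ae_eventually_sum_sub_lt hX hindep (a := 0)
    (fun z => if z = y then (1 : ℝ) else 0) (by intro z; split_ifs <;> simp)
  have hlo (y : Fin k) := ae_eventually_sum_sub_lt hX hindep (a := -1)
    (fun z => -(if z = y then (1 : ℝ) else 0)) (by intro z; split_ifs <;> simp)
  filter_upwards [ae_all_iff.2 hup, ae_all_iff.2 hlo] with ω h1 h2
  filter_upwards [eventually_all.2 h1, eventually_all.2 h2, eventually_ne_atTop 0]
    with n hn1 hn2 hn0 y
  have hn' : (0 : ℝ) < n := by exact_mod_cast Nat.pos_of_ne_zero hn0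
  have e : empirical (fun i : Fin n => X i ω) y - P₀ y =
      (∑ i ∈ Finset.range n, ((if X i ω = y then (1 : ℝ) else 0) - P₀ y)) / n := by
    rw [empirical_apply, Finset.sum_sub_distrib, ← Fin.sum_univ_eq_sum_range
      (fun i => if X i ω = y then (1 : ℝ) else 0)]
    simp
    field_simp
  have e2 : √(Real.log n / n) = √(n * Real.log n) / n := by
    rw [eq_div_iff hn'.ne', ← Real.sqrt_sq hn'.le, ← Real.sqrt_mul (by
      rw [Real.sqrt_sq hn'.le]; exact div_nonneg (Real.log_natCast_nonneg n) hn'.le),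
      Real.sqrt_sq hn'.le]
    congr 1
    field_simp
  have h1 := hn1 y
  have h2 := hn2 y
  simp only [integral_neg, hmean, Finset.sum_sub_distrib, Finset.sum_neg_distrib] at h1 h2
  rw [e, e2, abs_div, abs_of_pos hn']
  refine div_le_div_of_nonneg_right (abs_le.2 ⟨?_, ?_⟩) hn'.le <;>
    rw [Finset.sum_sub_distrib] <;> linarith

end Deviation

/-! ### The rate, and local estimates on the prior and on `α`. -/

/-- The rate for unit curvature. -/
lemma rate_one (n : ℕ) : rate n 1 = √(Real.log n / n) := by rw [rate, mul_one]

lemma rate_eq (n : ℕ) {lam : ℝ} (hlam : 0 < lam) : rate n lam = rate n 1 / √lam := by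
  rw [rate, rate_one, ← Real.sqrt_div' _ hlam.le, div_div]

lemma tendsto_rate_one : Tendsto (fun n : ℕ => rate n 1) atTop (𝓝 0) := by
  have h1 : Tendsto (fun x : ℝ => Real.log x / x) atTop (𝓝 0) := by
    simpa using Real.tendsto_pow_log_div_mul_add_atTop 1 0 1 one_ne_zero
  have h2 := (h1.comp tendsto_natCast_atTop_atTop).sqrt
  simpa [rate_one, Function.comp_def] using h2

lemma mul_sq_rate_one {n : ℕ} (hn : n ≠ 0) : n * rate n 1 ^ 2 = Real.log n := by
  have hn' : (0 : ℝ) < n := by exact_mod_cast Nat.pos_of_ne_zero hn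
  rw [rate_one, Real.sq_sqrt (div_nonneg (Real.log_natCast_nonneg n) hn'.le)]
  field_simp

lemma eventually_rpow_neg_half_le_rate_one :
    ∀ᶠ n : ℕ in atTop, (n : ℝ) ^ (-(1 / 2) : ℝ) ≤ rate n 1 := by
  -- From `3` on, `n` exceeds `e`, so `log n ≥ 1`.
  filter_upwards [eventually_ge_atTop 3] with n hn
  have hn3 : (3 : ℝ) ≤ n := by exact_mod_cast hn
  rw [rate_one]
  refine Real.le_sqrt_of_sq_le ?_
  rw [← Real.rpow_natCast, ← Real.rpow_mul (by positivity)]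
  norm_num
  rw [Real.rpow_neg_one, div_eq_mul_inv]
  refine le_mul_of_one_le_left (by positivity) ?_
  rw [Real.le_log_iff_exp_le (by positivity)]
  exact Real.exp_one_lt_three.le.trans hn3

/-- Lower bound on the prior mass of small balls around a point of positive density. -/
lemma exists_prior_ball_ge {prior : Measure (EuclideanSpace ℝ (Fin p))}
    {θ₀ : EuclideanSpace ℝ (Fin p)} {U : Set (EuclideanSpace ℝ (Fin p))} (hU : IsOpen U)
    (hθ₀U : θ₀ ∈ U) {f : EuclideanSpace ℝ (Fin p) → ℝ} (hfcont : ContinuousOn f U)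
    (hfpos : ∀ θ ∈ U, 0 < f θ)
    (hdens : prior.restrict U =
      (volume.restrict U).withDensity fun θ => ENNReal.ofReal (f θ)) :
    ∃ b > 0, ∃ ρ > 0, ∀ r, 0 < r → r ≤ ρ →
      ENNReal.ofReal (b * r ^ p) ≤ prior (Metric.ball θ₀ r) := by
  have h1 : ∀ᶠ θ in 𝓝 θ₀, f θ₀ / 2 < f θ :=
    (hfcont.continuousAt (hU.mem_nhds hθ₀U)).eventually_const_lt (half_lt_self (hfpos _ hθ₀U))
  obtain ⟨ρ, hρ, hball⟩ := Metric.mem_nhds_iff.1 (h1.and (hU.mem_nhds hθ₀U))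
  have hv0 : 0 < volume (Metric.ball (0 : EuclideanSpace ℝ (Fin p)) 1) :=
    Metric.measure_ball_pos _ _ one_pos
  have hv1 : volume (Metric.ball (0 : EuclideanSpace ℝ (Fin p)) 1) ≠ ⊤ := measure_ball_lt_top.ne
  have hf0 := hfpos _ hθ₀U
  have hV := ENNReal.toReal_pos hv0.ne' hv1
  refine ⟨f θ₀ / 2 * (volume (Metric.ball (0 : EuclideanSpace ℝ (Fin p)) 1)).toReal, by positivity,
    ρ, hρ, fun r hr hrρ => ?_⟩
  have hsub : Metric.ball θ₀ r ⊆ {θ | f θ₀ / 2 < f θ ∧ θ ∈ U} :=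
    (Metric.ball_subset_ball hrρ).trans hball
  have hsubU : Metric.ball θ₀ r ⊆ U := fun θ hθ => (hsub hθ).2
  have hrU {μ : Measure (EuclideanSpace ℝ (Fin p))} :
      μ (Metric.ball θ₀ r) = μ.restrict U (Metric.ball θ₀ r) := by
    rw [Measure.restrict_apply measurableSet_ball, Set.inter_eq_self_of_subset_left hsubU]
  rw [hrU, hdens, withDensity_apply _ measurableSet_ball,
    Measure.restrict_restrict measurableSet_ball, Set.inter_eq_self_of_subset_left hsubU]
  calc _ = ENNReal.ofReal (f θ₀ / 2) * volume (Metric.ball θ₀ r) := by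
        rw [Measure.addHaar_ball_of_pos _ _ hr, finrank_euclideanSpace_fin, mul_assoc,
          ENNReal.ofReal_mul (by positivity), ENNReal.ofReal_mul (by positivity),
          ENNReal.ofReal_toReal hv1, mul_comm (ENNReal.ofReal (r ^ p))]
    _ = ∫⁻ _ in Metric.ball θ₀ r, ENNReal.ofReal (f θ₀ / 2) := (setLIntegral_const _ _).symm
    _ ≤ _ := setLIntegral_mono' measurableSet_ball fun θ hθ =>
        ENNReal.ofReal_le_ofReal (hsub hθ).1.le

/-- Linear identification near `θ₀` combined with identification at a distance. -/
lemma exists_min_le_norm_sub {Θ : Set (EuclideanSpace ℝ (Fin p))}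
    {α : EuclideanSpace ℝ (Fin p) → EuclideanSpace ℝ (Fin d)} {θ₀ : EuclideanSpace ℝ (Fin p)}
    {α' : EuclideanSpace ℝ (Fin p) →L[ℝ] EuclideanSpace ℝ (Fin d)}
    (hderiv : HasFDerivAt α α' θ₀) (hinj : Function.Injective α')
    (hident : ∀ ε > 0, ∃ η > 0, ∀ θ ∈ Θ, ε ≤ ‖θ - θ₀‖ → η ≤ ‖α θ - α θ₀‖) :
    ∃ κ > 0, ∃ η > 0, ∀ θ ∈ Θ, min (κ * ‖θ - θ₀‖) η ≤ ‖α θ - α θ₀‖ := by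
  obtain ⟨K, hK, hanti⟩ := α'.toLinearMap.exists_antilipschitzWith
    (LinearMap.ker_eq_bot.2 hinj)
  have hK' : (0 : ℝ) < K := hK
  have hκ : (0 : ℝ) < (K : ℝ)⁻¹ / 2 := by positivity
  obtain ⟨ε, hε, hball⟩ := Metric.mem_nhds_iff.1
    ((hasFDerivAt_iff_isLittleO.1 hderiv).def hκ)
  obtain ⟨η, hη, hfar⟩ := hident ε hε
  refine ⟨(K : ℝ)⁻¹ / 2, hκ, η, hη, fun θ hθ => ?_⟩
  rcases le_or_gt ε ‖θ - θ₀‖ with hd | hd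
  · exact (min_le_right _ _).trans (hfar θ hθ hd)
  · refine (min_le_left _ _).trans ?_
    have h1 : ‖α θ - α θ₀ - α' (θ - θ₀)‖ ≤ (K : ℝ)⁻¹ / 2 * ‖θ - θ₀‖ :=
      hball (by rwa [Metric.mem_ball, dist_eq_norm])
    have h2 : ‖θ - θ₀‖ ≤ K * ‖α' (θ - θ₀)‖ := by
      simpa [dist_eq_norm] using hanti.le_mul_dist (θ - θ₀) 0
    have h3 : (K : ℝ)⁻¹ * ‖θ - θ₀‖ ≤ ‖α' (θ - θ₀)‖ := by
      rw [inv_mul_le_iff₀ hK']; exact h2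
    have h4 := norm_sub_norm_le (α' (θ - θ₀)) (α θ - α θ₀)
    rw [norm_sub_rev (α' (θ - θ₀))] at h4
    linarith

lemma exists_norm_sub_le_of_hasFDerivAt
    {α : EuclideanSpace ℝ (Fin p) → EuclideanSpace ℝ (Fin d)} {θ₀ : EuclideanSpace ℝ (Fin p)}
    {α' : EuclideanSpace ℝ (Fin p) →L[ℝ] EuclideanSpace ℝ (Fin d)}
    (hderiv : HasFDerivAt α α' θ₀) :
    ∃ L ≥ 0, ∃ ρ > 0, ∀ θ, ‖θ - θ₀‖ < ρ → ‖α θ - α θ₀‖ ≤ L * ‖θ - θ₀‖ := by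
  obtain ⟨L, hL, hO⟩ := hderiv.isBigO_sub.exists_nonneg
  obtain ⟨ρ, hρ, hball⟩ := Metric.mem_nhds_iff.1 hO.bound
  exact ⟨L, hL, ρ, hρ, fun θ hθ => hball (by rwa [Metric.mem_ball, dist_eq_norm])⟩

lemma norm_sum_smul_sub_le (h : Fin k → EuclideanSpace ℝ (Fin d)) (v w : Fin k → ℝ) :
    ‖∑ x, v x • h x - ∑ x, w x • h x‖ ≤ (∑ x, ‖h x‖) * ‖v - w‖ := by
  rw [← Finset.sum_sub_distrib, Finset.sum_mul]
  refine (norm_sum_le _ _).trans (Finset.sum_le_sum fun x _ => ?_)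
  rw [← sub_smul, norm_smul, mul_comm]
  exact mul_le_mul_of_nonneg_left (norm_le_pi_norm (v - w) x) (norm_nonneg _)

lemma eventually_mul_rate_one_lt (C : ℝ) {ρ : ℝ} (hρ : 0 < ρ) :
    ∀ᶠ n : ℕ in atTop, C * rate n 1 < ρ := by
  have := tendsto_rate_one.const_mul C
  rw [mul_zero] at this
  exact this.eventually_lt_const hρ

lemma rate_one_nonneg (n : ℕ) : 0 ≤ rate n 1 := Real.sqrt_nonneg _

/-! ### Posterior concentration and the predictive bound. -/

section Concentration

variable {Q : Fin k → ℝ} {h : Fin k → EuclideanSpace ℝ (Fin d)}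
  {Θ : Set (EuclideanSpace ℝ (Fin p))}
  {α : EuclideanSpace ℝ (Fin p) → EuclideanSpace ℝ (Fin d)}
  {θ₀ : EuclideanSpace ℝ (Fin p)}
  {α' : EuclideanSpace ℝ (Fin p) →L[ℝ] EuclideanSpace ℝ (Fin d)}
  {prior : Measure (EuclideanSpace ℝ (Fin p))}

/-- The information projection is pointwise Lipschitz in the parameter. -/
lemma exists_infoProj_comp_lipschitz (hQ : Q ∈ openSimplex k)
    (hfeas : ∀ θ ∈ Θ, (feasible h (α θ)).Nonempty) (hθ₀ : θ₀ ∈ interior Θ)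
    (hderiv : HasFDerivAt α α' θ₀) :
    ∃ L ≥ 0, ∃ ρ > 0, ∀ θ, ‖θ - θ₀‖ < ρ →
      θ ∈ Θ ∧ ‖infoProj Q h (α θ) - infoProj Q h (α θ₀)‖ ≤ L * ‖θ - θ₀‖ := by
  obtain ⟨C, hC, ρ₁, hρ₁, hC'⟩ :=
    exists_infoProj_lipschitz hQ (hfeas θ₀ (interior_subset hθ₀))
  obtain ⟨L, hL, ρ₂, hρ₂, hL'⟩ := exists_norm_sub_le_of_hasFDerivAt hderiv
  obtain ⟨ρ₃, hρ₃, hball⟩ := Metric.mem_nhds_iff.1 (mem_interior_iff_mem_nhds.1 hθ₀)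
  refine ⟨C * L, by positivity, min (min ρ₂ ρ₃) (ρ₁ / (L + 1)), by positivity, fun θ hθ => ?_⟩
  obtain ⟨⟨h2, h3⟩, h1⟩ := by simpa only [lt_min_iff] using hθ
  have hθΘ : θ ∈ Θ := hball (by rwa [Metric.mem_ball, dist_eq_norm])
  have hα := hL' θ h2
  refine ⟨hθΘ, (hC' _ (hfeas θ hθΘ) ?_).trans ?_⟩
  · rw [lt_div_iff₀ (by positivity)] at h1
    nlinarith [norm_nonneg (θ - θ₀)]
  · rw [mul_assoc]
    exact mul_le_mul_of_nonneg_left hα hC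

variable [IsProbabilityMeasure prior]

/-- Posterior concentration for all samples whose moments deviate at the parametric rate. -/
theorem exists_posterior_le (hQ : Q ∈ openSimplex k)
    (hfeas : ∀ θ ∈ Θ, (feasible h (α θ)).Nonempty) (hθ₀ : θ₀ ∈ interior Θ)
    (hderiv : HasFDerivAt α α' θ₀) (hinj : Function.Injective α')
    (hident : ∀ ε > 0, ∃ η > 0, ∀ θ ∈ Θ, ε ≤ ‖θ - θ₀‖ → η ≤ ‖α θ - α θ₀‖)
    (hprior : prior Θᶜ = 0)
    {U : Set (EuclideanSpace ℝ (Fin p))} (hU : IsOpen U) (hθ₀U : θ₀ ∈ U)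
    {f : EuclideanSpace ℝ (Fin p) → ℝ} (hfcont : ContinuousOn f U) (hfpos : ∀ θ ∈ U, 0 < f θ)
    (hdens : prior.restrict U =
      (volume.restrict U).withDensity fun θ => ENNReal.ofReal (f θ))
    {M : ℝ} (hM : 0 ≤ M) {c : ℝ} (hc : 0 < c) :
    ∃ C > 0, ∃ K > 0, ∀ᶠ n : ℕ in atTop, ∀ x : Fin n → Fin k,
      ‖∑ y, empirical x y • h y - α θ₀‖ ≤ M * rate n 1 →
      posterior Q h α prior x {θ | C * rate n 1 < ‖θ - θ₀‖} ≤
        ENNReal.ofReal (K * (n : ℝ) ^ (-c)) := by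
  have hP₀ := (infoProj_spec hQ (hfeas θ₀ (interior_subset hθ₀))).1
  obtain ⟨C₁, hC₁, ρ₁, hρ₁, hnear⟩ := exists_openSimplex_near h hP₀.1
  obtain ⟨L, hL, ρ₂, hρ₂, hlip⟩ := exists_infoProj_comp_lipschitz hQ hfeas hθ₀ hderiv
  obtain ⟨b, hb, ρ₃, hρ₃, hmass⟩ := exists_prior_ball_ge hU hθ₀U hfcont hfpos hdens
  obtain ⟨δ, hδ, hPδ⟩ := exists_pos_le hP₀.1.1
  obtain ⟨κ, hκ, η, hη, hsep⟩ := exists_min_le_norm_sub hderiv hinj hident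
  set P₀ := infoProj Q h (α θ₀)
  set H := ∑ x, ‖h x‖ + 1
  have hH : 0 < H := add_pos_of_nonneg_of_pos (Finset.sum_nonneg fun _ _ => norm_nonneg _) one_pos
  -- On the ball of radius `s`, `S` and `P*_θ` lie within `C₁ * M * s` and `L * s` of `P₀`, and
  -- `P*_θ ≥ δ / 2`; hence `kl ≤ G * s²`.
  set G := k / (δ / 2) * (C₁ * M + L) ^ 2
  have hG : 0 ≤ G := by positivity
  -- The exponent `w²` must pay for the likelihood near `θ₀` (`G`), the prior mass of the ball (`p /
  -- 2`) and the target rate (`c`).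
  set w := √(G + p / 2 + c)
  have hw : 0 < w := Real.sqrt_pos.2 (by positivity)
  have hw2 : w ^ 2 = G + p / 2 + c := Real.sq_sqrt (by positivity)
  -- Of the separation `κ * C * s`, the sampling error takes `M * s`. The remaining `2 * H * w * s`
  -- forces `‖S - P*_θ‖ ≥ 2 * w * s`, and the factor `1 / 4` in the lower bound on `kl` leaves `w² *
  -- s²`.
  set C := (M + 2 * H * w) / κ
  have hC : κ * C = M + 2 * H * w := by simp only [C]; field_simp
  refine ⟨C, by positivity, b⁻¹, by positivity, ?_⟩
  filter_upwards [eventually_ge_atTop 3, eventually_rpow_neg_half_le_rate_one,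
    eventually_mul_rate_one_lt M hρ₁, eventually_mul_rate_one_lt 1 hρ₂,
    eventually_mul_rate_one_lt 1 hρ₃, eventually_mul_rate_one_lt L (half_pos hδ),
    eventually_mul_rate_one_lt (κ * C) hη] with n hn hs hs1 hs2 hs3 hs4 hs5 x hx
  have hn0 : n ≠ 0 := by omega
  have hn' : (0 : ℝ) < n := by exact_mod_cast Nat.pos_of_ne_zero hn0
  have hspos : 0 < rate n 1 := (Real.rpow_pos_of_pos hn' _).trans_le hs
  have hns := mul_sq_rate_one hn0
  set s := rate n 1
  rw [one_mul] at hs2 hs3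
  obtain ⟨S, hS, hSx, hSn⟩ := hnear (empirical x) (sum_empirical hn0 x)
    (by rw [hP₀.2]; exact hx.trans_lt hs1)
  rw [hP₀.2] at hSn
  obtain ⟨D, hD, hlik⟩ := exists_iidLaw_infoProj_eq hQ hn0 x hS hSx
  have hupper : ∀ᵐ θ ∂prior, θ ∈ {θ | C * s < ‖θ - θ₀‖} →
      iidLaw (infoProj Q h (α θ)) n x ≤ D * Real.exp (-(w ^ 2 * Real.log n)) := by
    have hΘ : ∀ᵐ θ ∂prior, θ ∈ Θ := hprior
    filter_upwards [hΘ] with θ hθ hθA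
    rw [hlik _ (hfeas θ hθ)]
    have hPθ := (infoProj_spec hQ (hfeas θ hθ)).1
    have h1 : κ * C * s ≤ ‖α θ - α θ₀‖ := by
      refine le_trans (le_min ?_ hs5.le) (hsep θ hθ)
      rw [mul_assoc]
      exact mul_le_mul_of_nonneg_left hθA.le hκ.le
    have h2 : ‖α θ - α θ₀‖ ≤ M * s + ‖∑ y, S y • h y - α θ‖ := by
      rw [hSx]
      have := norm_sub_le (∑ y, empirical x y • h y - α θ₀) (∑ y, empirical x y • h y - α θ)
      rw [sub_sub_sub_cancel_left] at this
      linarith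
    have h3 : ‖∑ y, S y • h y - α θ‖ ≤ H * ‖S - infoProj Q h (α θ)‖ := by
      have := norm_sum_smul_sub_le h S (infoProj Q h (α θ))
      rw [hPθ.2] at this
      refine this.trans (mul_le_mul_of_nonneg_right ?_ (norm_nonneg _))
      simp [H]
    have h4 : 2 * w * s ≤ ‖S - infoProj Q h (α θ)‖ := by
      rw [hC] at h1
      refine le_of_mul_le_mul_left ?_ hH
      linarith
    have h5 : w ^ 2 * s ^ 2 ≤ kl S (infoProj Q h (α θ)) := by
      refine le_trans ?_ (sq_norm_sub_le_kl hS hPθ.1)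
      nlinarith [mul_pos hw hspos]
    have h6 := mul_le_mul_of_nonneg_left h5 hn'.le
    refine mul_le_mul_of_nonneg_left (Real.exp_le_exp.2 (neg_le_neg ?_)) hD.le
    rw [← hns]
    linarith
  have hlower : ∀ θ ∈ Metric.ball θ₀ s,
      D * Real.exp (-(G * Real.log n)) ≤ iidLaw (infoProj Q h (α θ)) n x := by
    intro θ hθ
    rw [Metric.mem_ball, dist_eq_norm] at hθ
    obtain ⟨hθΘ, hPθ⟩ := hlip θ (hθ.trans hs2)
    rw [hlik _ (hfeas θ hθΘ)]
    have hmem := (infoProj_spec hQ (hfeas θ hθΘ)).1.1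
    have h1 : ‖infoProj Q h (α θ) - P₀‖ ≤ L * s :=
      hPθ.trans (mul_le_mul_of_nonneg_left hθ.le hL)
    have h2 (y) : δ / 2 ≤ infoProj Q h (α θ) y := by
      have := norm_le_pi_norm (infoProj Q h (α θ) - P₀) y
      rw [Real.norm_eq_abs, Pi.sub_apply] at this
      linarith [hPδ y, neg_abs_le (infoProj Q h (α θ) y - P₀ y)]
    have h3 : ‖S - infoProj Q h (α θ)‖ ≤ (C₁ * M + L) * s := by
      have := norm_sub_le (S - P₀) (infoProj Q h (α θ) - P₀)
      rw [sub_sub_sub_cancel_right] at this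
      have := mul_le_mul_of_nonneg_left hx hC₁
      linarith
    have h4 : kl S (infoProj Q h (α θ)) ≤ G * s ^ 2 := by
      refine (kl_le_sq_norm_sub hS hmem (half_pos hδ) h2).trans ?_
      rw [mul_assoc, ← mul_pow]
      gcongr
    have h5 := mul_le_mul_of_nonneg_left h4 hn'.le
    refine mul_le_mul_of_nonneg_left (Real.exp_le_exp.2 (neg_le_neg ?_)) hD.le
    rw [← hns]
    linarith
  have hA : MeasurableSet {θ : EuclideanSpace ℝ (Fin p) | C * s < ‖θ - θ₀‖} :=
    measurableSet_lt (by fun_prop) (by fun_prop)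
  refine (posterior_le_of_iidLaw_le x hA measurableSet_ball (by positivity) (by positivity)
    hupper hlower (hmass s hspos hs3.le)).trans (ENNReal.ofReal_le_ofReal ?_)
  have hexp (t : ℝ) : Real.exp (-(t * Real.log n)) = (n : ℝ) ^ (-t) := by
    rw [Real.rpow_def_of_pos hn']; congr 1; ring
  have hsp : (n : ℝ) ^ (-(p / 2 : ℝ)) ≤ s ^ p := by
    refine le_trans (le_of_eq ?_) (pow_le_pow_left₀ (by positivity) hs p)
    rw [← Real.rpow_natCast, ← Real.rpow_mul hn'.le]
    congr 1; ring
  rw [hexp, hexp, div_le_iff₀ (by positivity)]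
  calc D * (n : ℝ) ^ (-w ^ 2) =
        b⁻¹ * (n : ℝ) ^ (-c) * (D * (n : ℝ) ^ (-G) * (b * (n : ℝ) ^ (-(p / 2 : ℝ)))) := by
        rw [hw2, show -(G + p / 2 + c) = -G + -(p / 2 : ℝ) + -c by ring, Real.rpow_add hn',
          Real.rpow_add hn']
        field_simp
    _ ≤ _ := by gcongr

/-- Convergence of the predictive law for all samples whose moments deviate at the parametric
rate. -/
theorem exists_tvDist_predictive_le (hQ : Q ∈ openSimplex k)
    (hfeas : ∀ θ ∈ Θ, (feasible h (α θ)).Nonempty) (hθ₀ : θ₀ ∈ interior Θ)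
    (hderiv : HasFDerivAt α α' θ₀)
    (hP : AEMeasurable (fun θ => infoProj Q h (α θ)) prior) {C K M : ℝ} (hC : 0 < C) (hK : 0 < K)
    (hpost : ∀ᶠ n : ℕ in atTop, ∀ x : Fin n → Fin k,
      ‖∑ y, empirical x y • h y - α θ₀‖ ≤ M * rate n 1 →
      posterior Q h α prior x {θ | C * rate n 1 < ‖θ - θ₀‖} ≤
        ENNReal.ofReal (K * (n : ℝ) ^ (-(1 / 2) : ℝ))) :
    ∃ K' > 0, ∀ᶠ n : ℕ in atTop, ∀ x : Fin n → Fin k,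
      ‖∑ y, empirical x y • h y - α θ₀‖ ≤ M * rate n 1 → ∀ m : ℕ,
      tvDist (predictive Q h α prior x m) (iidLaw (infoProj Q h (α θ₀)) m) ≤
        K' * (m * rate n 1) := by
  have hP₀ := infoProj_mem_openSimplex hQ h (α θ₀)
  obtain ⟨L, hL, ρ, hρ, hlip⟩ := exists_infoProj_comp_lipschitz hQ hfeas hθ₀ hderiv
  refine ⟨(k + 1) * (L * C + K), by positivity, ?_⟩
  filter_upwards [hpost, eventually_mul_rate_one_lt C hρ, eventually_rpow_neg_half_le_rate_one]
    with n hn hsρ hs x hx m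
  have hprob := isProbabilityMeasure_posterior hQ hP x
  refine (tvDist_predictive_le hQ hP x m hP₀).trans ?_
  have hs0 := rate_one_nonneg n
  have hnx := hn x hx
  set s := rate n 1
  set ν := posterior Q h α prior x
  set A := {θ : EuclideanSpace ℝ (Fin p) | C * s < ‖θ - θ₀‖}
  have hA : MeasurableSet A := measurableSet_lt (by fun_prop) (by fun_prop)
  have hνA : ν.real A ≤ K * s := by
    refine (ENNReal.toReal_mono ENNReal.ofReal_ne_top hnx).trans ?_
    rw [ENNReal.toReal_ofReal (by positivity)]
    gcongr
  have hint : ∫ θ, ‖infoProj Q h (α θ) - infoProj Q h (α θ₀)‖ ∂ν ≤ (L * C + K) * s := by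
    have hiA : Integrable (A.indicator (1 : EuclideanSpace ℝ (Fin p) → ℝ)) ν :=
      (integrable_const (1 : ℝ)).indicator hA
    -- Off `A` the Lipschitz bound applies; on `A` the distance is at most `1` and the posterior
    -- mass is `O(s)`.
    calc _ ≤ ∫ θ, (L * (C * s) + A.indicator (1 : EuclideanSpace ℝ (Fin p) → ℝ) θ) ∂ν := by
          refine integral_mono_of_nonneg (Eventually.of_forall fun _ => norm_nonneg _)
            ((integrable_const _).add hiA) (Eventually.of_forall fun θ => ?_)
          by_cases hθ : θ ∈ A
          · have := norm_sub_le_one (infoProj_mem_openSimplex hQ h (α θ)) hP₀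
            have : 0 ≤ L * (C * s) := by positivity
            simp only [Set.indicator_of_mem hθ, Pi.one_apply]
            linarith
          · have hθ' : ‖θ - θ₀‖ ≤ C * s := not_lt.1 hθ
            simp only [Set.indicator_of_notMem hθ, add_zero]
            exact (hlip θ (hθ'.trans_lt hsρ)).2.trans (mul_le_mul_of_nonneg_left hθ' hL)
      _ = L * (C * s) + ν.real A := by
          rw [integral_add (integrable_const _) hiA, integral_indicator_one hA]
          simp
      _ ≤ _ := by linarith
  calc _ ≤ (m : ℝ) * (k * ((L * C + K) * s)) := by gcongr
    _ ≤ (m : ℝ) * ((k + 1) * ((L * C + K) * s)) := by gcongr; linarith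
    _ = _ := by ring

end Concentration

end BETEL

theorem mainTheorem7 {k d p : ℕ}
    -- the reference law, the feature map and the moment constraint
    (Q : Fin k → ℝ) (hQ : Q ∈ BETEL.openSimplex k)
    (h : Fin k → EuclideanSpace ℝ (Fin d))
    (hT : BETEL.tangentSpace h ≠ ⊥)
    (Θ : Set (EuclideanSpace ℝ (Fin p))) (hΘ : MeasurableSet Θ)
    (α : EuclideanSpace ℝ (Fin p) → EuclideanSpace ℝ (Fin d))
    (hα : ContinuousOn α Θ)
    (hfeas : ∀ θ ∈ Θ, (BETEL.feasible h (α θ)).Nonempty)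
    -- smoothness, interiority and identification at the true parameter
    (θ₀ : EuclideanSpace ℝ (Fin p)) (hθ₀ : θ₀ ∈ interior Θ)
    (α' : EuclideanSpace ℝ (Fin p) →L[ℝ] EuclideanSpace ℝ (Fin d))
    (hderiv : HasFDerivAt α α' θ₀) (hinj : Function.Injective α')
    (hident : ∀ ε > 0, ∃ η > 0, ∀ θ ∈ Θ, ε ≤ ‖θ - θ₀‖ → η ≤ ‖α θ - α θ₀‖)
    -- the prior, with a positive continuous density near the true parameter
    (prior : Measure (EuclideanSpace ℝ (Fin p))) [IsProbabilityMeasure prior]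
    (hprior : prior Θᶜ = 0)
    (U : Set (EuclideanSpace ℝ (Fin p))) (hU : IsOpen U) (hθ₀U : θ₀ ∈ U)
    (f : EuclideanSpace ℝ (Fin p) → ℝ) (hfcont : ContinuousOn f U) (hfpos : ∀ θ ∈ U, 0 < f θ)
    (hdens : prior.restrict U =
      (volume.restrict U).withDensity fun θ => ENNReal.ofReal (f θ))
    -- independent observations whose law satisfies the constraint at the true parameter
    {Ω : Type*} [MeasurableSpace Ω] (Pr : Measure Ω) [IsProbabilityMeasure Pr]
    (X : ℕ → Ω → Fin k) (hX : ∀ i, Measurable (X i)) (hindep : iIndepFun X Pr)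
    (P₀ : Fin k → ℝ) (hlaw : ∀ i x, Pr.real (X i ⁻¹' {x}) = P₀ x)
    (hP₀ : ∑ x, P₀ x • h x = α θ₀) :
    -- the posterior is well defined
    (∀ (n : ℕ) (x : Fin n → Fin k), IsProbabilityMeasure (BETEL.posterior Q h α prior x)) ∧
    -- posterior concentration
    (∀ c : ℝ, 0 < c → ∃ C > 0, ∃ K > 0,
      (∀ᵐ ω ∂Pr, ∀ᶠ n : ℕ in atTop,
        BETEL.posterior Q h α prior (fun i : Fin n => X i ω)
          {θ | C * BETEL.rate n (BETEL.curvature h (BETEL.infoProj Q h (α θ₀))) < ‖θ - θ₀‖}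
          ≤ ENNReal.ofReal (K * (n : ℝ) ^ (-c))) ∧
      (∀ᶠ n : ℕ in atTop, ∀ x : Fin n → Fin k,
        BETEL.empirical x ∈ BETEL.feasible h (α θ₀) →
        BETEL.posterior Q h α prior x
          {θ | C * BETEL.rate n (BETEL.curvature h (BETEL.infoProj Q h (α θ₀))) < ‖θ - θ₀‖}
          ≤ ENNReal.ofReal (K * (n : ℝ) ^ (-c)))) ∧
    -- predictive law, uniformly in the number `m` of future observations
    (∃ K > 0,
      (∀ᵐ ω ∂Pr, ∀ᶠ n : ℕ in atTop, ∀ m : ℕ,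
        BETEL.tvDist (BETEL.predictive Q h α prior (fun i : Fin n => X i ω) m)
          (BETEL.iidLaw (BETEL.infoProj Q h (α θ₀)) m)
          ≤ K * (m * BETEL.rate n (BETEL.curvature h (BETEL.infoProj Q h (α θ₀))))) ∧
      (∀ᶠ n : ℕ in atTop, ∀ x : Fin n → Fin k,
        BETEL.empirical x ∈ BETEL.feasible h (α θ₀) → ∀ m : ℕ,
        BETEL.tvDist (BETEL.predictive Q h α prior x m)
          (BETEL.iidLaw (BETEL.infoProj Q h (α θ₀)) m)
          ≤ K * (m * BETEL.rate n (BETEL.curvature h (BETEL.infoProj Q h (α θ₀)))))) := by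
  have hP := BETEL.aemeasurable_infoProj hQ hΘ hα hfeas hprior
  have hP₀_proj := BETEL.infoProj_mem_openSimplex hQ h (α θ₀)
  have hlam := BETEL.curvature_pos hT hP₀_proj
  set lam := BETEL.curvature h (BETEL.infoProj Q h (α θ₀))
  have hsq : 0 < √lam := Real.sqrt_pos.2 hlam
  set M := ∑ y, ‖h y‖
  have hM : 0 ≤ M := Finset.sum_nonneg fun _ _ => norm_nonneg _
  have hdev : ∀ᵐ ω ∂Pr, ∀ᶠ n : ℕ in atTop,
      ‖∑ y, BETEL.empirical (fun i : Fin n => X i ω) y • h y - α θ₀‖ ≤ M * BETEL.rate n 1 := by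
    filter_upwards [BETEL.ae_eventually_abs_empirical_sub_le hX hindep hlaw] with ω hω
    filter_upwards [hω] with n hn
    rw [← hP₀]
    refine (BETEL.norm_sum_smul_sub_le h _ _).trans (mul_le_mul_of_nonneg_left ?_ hM)
    refine (pi_norm_le_iff_of_nonneg (BETEL.rate_one_nonneg n)).2 fun y => ?_
    rw [BETEL.rate_one]
    exact hn y
  have hexact (n : ℕ) (x : Fin n → Fin k) (hx : BETEL.empirical x ∈ BETEL.feasible h (α θ₀)) :
      ‖∑ y, BETEL.empirical x y • h y - α θ₀‖ ≤ M * BETEL.rate n 1 := by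
    rw [hx.2, sub_self, norm_zero]
    exact mul_nonneg hM (BETEL.rate_one_nonneg n)
  have hpost {c : ℝ} (hc : 0 < c) := BETEL.exists_posterior_le hQ hfeas hθ₀ hderiv hinj hident
    hprior hU hθ₀U hfcont hfpos hdens hM hc
  refine ⟨fun n x => BETEL.isProbabilityMeasure_posterior hQ hP x, fun c hc => ?_, ?_⟩
  · obtain ⟨C, hC, K, hK, hev⟩ := hpost hc
    -- The factor `√lam` in the constant cancels the curvature in the rate.
    have hr (n : ℕ) : C * √lam * BETEL.rate n lam = C * BETEL.rate n 1 := by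
      rw [BETEL.rate_eq n hlam]; field_simp
    refine ⟨C * √lam, by positivity, K, hK, ?_, ?_⟩
    · filter_upwards [hdev] with ω hω
      filter_upwards [hω, hev] with n hn hn'
      rw [hr]
      exact hn' _ hn
    · filter_upwards [hev] with n hn x hx
      rw [hr]
      exact hn x (hexact n x hx)
  -- The exponent `1 / 2` suffices, since `n^(-1/2)` is eventually below the rate.
  · obtain ⟨C, hC, K, hK, hev⟩ := hpost (c := 1 / 2) (by norm_num)
    obtain ⟨K', hK', hev'⟩ :=
      BETEL.exists_tvDist_predictive_le hQ hfeas hθ₀ hderiv hP hC hK hev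
    have hr (n m : ℕ) : K' * √lam * (m * BETEL.rate n lam) = K' * (m * BETEL.rate n 1) := by
      rw [BETEL.rate_eq n hlam]; field_simp
    refine ⟨K' * √lam, by positivity, ?_, ?_⟩
    · filter_upwards [hdev] with ω hω
      filter_upwards [hω, hev'] with n hn hn' m
      rw [hr]
      exact hn' _ hn m
    · filter_upwards [hev'] with n hn x hx m
      rw [hr]
      exact hn x (hexact n x hx) m
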